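/- Let $X=(X_i)_{i\ge 1}$ be i.i.d. Bernoulli variables with parameter $p$, and let $U=(U_i)_{i\ge1}$ be i.i.d. uniform variables on $(0,1)$, independent of $X$. A (possibly randomized) procedure consists of measurable functions $\tau_n,\gamma_n$, $n\ge1$, of $(x_1,u_1),\dots,(x_n,u_n)$ with values in $\{0,1\}$, which do not depend on $p$. Its stopping time $N$ is the smallest $n\ge 1$ with $\tau_n(X_1,U_1;\dots;X_n,U_n)=1$ ($N=\infty$ if there is none), and its output is $Y=\gamma_N(X_1,U_1;\dots;X_N,U_N)$. (It is non-randomized if the functions $\tau_n,\gamma_n$ do not depend on the $u_i$.) For $S\subseteq(0,1)$ and $f:S\to(0,1)$, the procedure is a Bernoulli factory for $f$ if, for every $p\in S$, $N<\infty$ almost surely and $Y$ is a Bernoulli variable with parameter $f(p)$. It is fast if for every $p\in S$ there are $A>0$ and $\beta<1$, possibly depending on $p$, such that $\Pr[N>n]\le A\beta^n$ for all integers $n\ge0$. For real functions $g,h$ on $S$, write $g(p)=\Omega(h(p))$ as $p\to0$ if there are $C,\delta>0$ such that $g(p)\ge C\,h(p)$ for all $p\in S$ with $|p|<\delta$. **Theorem.**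 Let $S\subseteq(0,1)$ be an open set that has $0$ as a limit point, and let $f:S\to(0,1)$ be a differentiable function with $f'(p)=\Omega(f(p)/p)$ as $p\to0$. Then every (possibly randomized) Bernoulli factory for $f$ that is fast satisfies $$\mathrm{E}[N]=\Omega(f(p)/p)\quad\text{as } p\to0 .$$ -/

import Mathlib

open MeasureTheory ProbabilityTheory Set

noncomputable section

namespace BernoulliFactory

/-- The law of one pair `(X_i, U_i)`: an input bit `X_i` (with `true` for `1`) that is Bernoulli with
parameter `p`, and an independent `U_i` that is uniform on `(0,1)`. The projection onto `[0,1]` is the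
identity on the parameters `p ∈ (0,1)` that are used. -/
def stepLaw (p : ℝ) : Measure (Bool × ℝ) :=
  (bernoulliMeasure true false (projIcc (0 : ℝ) 1 zero_le_one p)).prod
    ((volume : Measure ℝ).restrict (Ioo 0 1))

/-- The joint law of the input sequence `X` and the randomizing sequence `U`: the pairs
`(X_1, U_1), (X_2, U_2), …` are independent with law `stepLaw p`.
The pair `(X_i, U_i)` is the coordinate `ω (i - 1)` of a sample point `ω`. -/
def inputLaw (p : ℝ) : Measure (ℕ → Bool × ℝ) :=
  Measure.infinitePi fun _ => stepLaw p

/-- The first `n` pairs `(X_1, U_1), …, (X_n, U_n)`. -/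
def firstInputs (n : ℕ) (ω : ℕ → Bool × ℝ) : Fin n → Bool × ℝ :=
  fun i => ω i

/-- A (possibly randomized) procedure: measurable stopping functions `τ_n` and measurable output
functions `γ_n` of `(x_1, u_1), …, (x_n, u_n)`. Neither may depend on the parameter `p`. The functions
with index `n = 0` play no role. The non-randomized procedures are those whose functions ignore the
`u_i`. -/
structure Procedure where
  /-- The stopping function `τ_n`. -/
  stopFun : (n : ℕ) → (Fin n → Bool × ℝ) → Bool
  /-- The output function `γ_n`. -/
  outputFun : (n : ℕ) → (Fin n → Bool × ℝ) → Bool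
  measurable_stopFun : ∀ n, Measurable (stopFun n)
  measurable_outputFun : ∀ n, Measurable (outputFun n)

namespace Procedure

/-- The stopping time `N`: the smallest `n ≥ 1` with `τ_n = 1`, and `∞` if there is none. -/
def stoppingTime (B : Procedure) (ω : ℕ → Bool × ℝ) : ℕ∞ :=
  sInf {m : ℕ∞ | ∃ n : ℕ, m = n ∧ 1 ≤ n ∧ B.stopFun n (firstInputs n ω) = true}

/-- The output `Y = γ_N((X_1, U_1), …, (X_N, U_N))`; its value where `N = ∞` is immaterial. -/
def outputValue (B : Procedure) (ω : ℕ → Bool × ℝ) : Bool :=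
  B.outputFun (B.stoppingTime ω).toNat (firstInputs (B.stoppingTime ω).toNat ω)

/-- `B` is a Bernoulli factory for `f` on `S`: for each `p ∈ S`, when the inputs have parameter `p`,
`N` is almost surely finite and `Y` is a Bernoulli variable with parameter `f p`. -/
def IsFactoryFor (B : Procedure) (S : Set ℝ) (f : ℝ → ℝ) : Prop :=
  ∀ p ∈ S, (∀ᵐ ω ∂inputLaw p, B.stoppingTime ω < ⊤) ∧
    (inputLaw p).real {ω | B.outputValue ω = true} = f p

/-- `B` is fast on `S`: for each `p ∈ S` the tail of `N` is exponential, with constants that may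
depend on `p`. -/
def IsFast (B : Procedure) (S : Set ℝ) : Prop :=
  ∀ p ∈ S, ∃ A > (0 : ℝ), ∃ β < (1 : ℝ),
    ∀ n : ℕ, (inputLaw p).real {ω | (n : ℕ∞) < B.stoppingTime ω} ≤ A * β ^ n

/-- The expected number of inputs `E[N]` when the inputs have parameter `p`, as an extended
non-negative number. -/
def expectedInputs (B : Procedure) (p : ℝ) : ENNReal :=
  ∫⁻ ω, (B.stoppingTime ω : ENNReal) ∂inputLaw p

end Procedure

/-- `g(x) = Ω(h(x))` as `x → x₀`, for functions on the domain `S`. -/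
def IsOmega (S : Set ℝ) (x₀ : ℝ) (g h : ℝ → ℝ) : Prop :=
  ∃ C > (0 : ℝ), ∃ δ > (0 : ℝ), ∀ x ∈ S, |x - x₀| < δ → C * h x ≤ g x

end BernoulliFactory

end

/-!
The theorem follows from a sequential Cramér–Rao (information) inequality. For a fast Bernoulli
factory for `f`, every `p ∈ S` and every weight `c > 0`,
`f' p ≤ (c * f p + E[N] / (p * (1 - p) * c)) / 2` (`Procedure.IsFactoryFor.deriv_le`).
With `f' p ≥ C * f p / p` and `c = C / p`, the first term on the right is half of the lower bound
for `f' p`, and the second one must make up the other half: `E[N] ≥ C ^ 2 * (1 - p) * f p / p`.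

To prove the inequality, let the procedure be truncated after `n` inputs. The probability `g p` of
`N ≤ n` and `Y = 1` is then a polynomial in `p`, whose derivative is the integral over this event
of the total score of the `n` inputs (`hasDerivAt_inputLaw_real`). Scores are centred given the
past, so those of inputs that are not read may be dropped
(`Procedure.setIntegral_score_eq_stoppedScore`), and what remains is a martingale whose second
moment is given by Wald's identity (`integral_stoppedScore_sq`). The inequality
`2 * M ≤ c + M ^ 2 / c` then gives `g' p ≤ (c * g p + E[min N n] / (p * (1 - p) * c)) / 2`.

The passage `n → ∞` avoids differentiating a series: the bounds on the derivatives of the truncated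
probabilities are integrated over a short interval, where the limit is taken pointwise, and the
interval is then shrunk to `p`. This needs a bound for `E[N]` near `p` that is continuous at `p`.
It comes from the exponential tail at `p` alone, because a change of the parameter from `p` to `t`
multiplies the probability of `N > n` by at most the `n`-th power of a ratio that tends to `1` as
`t → p` (`inputLaw_real_le_pow_mul`).
-/

namespace BernoulliFactory

/-! ### The law of the first inputs as a function of the parameter -/

/-- The probability `p` or `1 - p` of the bit `b` under the Bernoulli law with parameter `p`. -/
def bitWeight (p : ℝ) (b : Bool) : ℝ := if b then p else 1 - p

/-- The score of one Bernoulli input: the logarithmic derivative of `bitWeight p b` in `p`. -/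
noncomputable def score (p : ℝ) (b : Bool) : ℝ := if b then p⁻¹ else -(1 - p)⁻¹

lemma bitWeight_pos {p : ℝ} (hp : p ∈ Ioo (0 : ℝ) 1) (b : Bool) : 0 < bitWeight p b := by
  cases b <;> simp [bitWeight, hp.1, hp.2]

lemma hasDerivAt_bitWeight {p : ℝ} (hp : p ∈ Ioo (0 : ℝ) 1) (b : Bool) :
    HasDerivAt (fun q => bitWeight q b) (bitWeight p b * score p b) p := by
  have h1 : p ≠ 0 := hp.1.ne'
  have h2 : 1 - p ≠ 0 := (sub_pos.2 hp.2).ne'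
  cases b
  · simpa [bitWeight, score, h2] using (hasDerivAt_id p).const_sub 1
  · simpa [bitWeight, score, h1] using hasDerivAt_id' p

lemma hasDerivAt_prod_bitWeight {p : ℝ} (hp : p ∈ Ioo (0 : ℝ) 1) {n : ℕ} (x : Fin n → Bool) :
    HasDerivAt (fun q => ∏ i, bitWeight q (x i))
      ((∏ i, bitWeight p (x i)) * ∑ i, score p (x i)) p := by
  have h := HasDerivAt.fun_finsetProd (u := Finset.univ)
    (fun i _ => hasDerivAt_bitWeight hp (x i))
  refine h.congr_deriv ?_
  rw [Finset.mul_sum]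
  refine Finset.sum_congr rfl fun i _ => ?_
  rw [smul_eq_mul, ← mul_assoc, Finset.prod_erase_mul _ _ (Finset.mem_univ i)]

instance : IsProbabilityMeasure ((volume : Measure ℝ).restrict (Ioo 0 1)) :=
  ⟨by simp⟩

instance (p : ℝ) : IsProbabilityMeasure (stepLaw p) := by
  unfold stepLaw; infer_instance

instance (p : ℝ) : IsProbabilityMeasure (inputLaw p) := by
  unfold inputLaw; infer_instance

lemma bernoulliMeasure_real_singleton {p : ℝ} (hp : p ∈ Ioo (0 : ℝ) 1) (b : Bool) :
    (bernoulliMeasure true false (projIcc (0 : ℝ) 1 zero_le_one p)).real {b} = bitWeight p b := by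
  rw [projIcc_of_mem zero_le_one (Ioo_subset_Icc_self hp),
    bernoulliMeasure_real_apply _ (measurableSet_singleton b)]
  cases b <;> simp [bitWeight]

lemma measurable_firstInputs (n : ℕ) : Measurable (firstInputs n) := by
  unfold firstInputs; fun_prop

lemma map_firstInputs (p : ℝ) (n : ℕ) :
    (inputLaw p).map (firstInputs n) = Measure.pi fun _ : Fin n => stepLaw p := by
  rw [← Measure.infinitePi_eq_pi]
  exact Measure.map_infinitePi_infinitePi_of_inj (P := fun _ : ℕ => stepLaw p)
    Fin.val_injective

/-- The information in the first `n` inputs. -/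
abbrev past (n : ℕ) : MeasurableSpace (ℕ → Bool × ℝ) :=
  MeasurableSpace.comap (firstInputs n) inferInstance

lemma past_le (n : ℕ) : past n ≤ (inferInstance : MeasurableSpace (ℕ → Bool × ℝ)) :=
  (measurable_firstInputs n).comap_le

lemma past_mono : Monotone past := by
  intro m n hmn
  have h : firstInputs m =
      (fun (y : Fin n → Bool × ℝ) (i : Fin m) => y (Fin.castLE hmn i)) ∘ firstInputs n := rfl
  rw [past, past, h, ← MeasurableSpace.comap_comp]
  exact MeasurableSpace.comap_mono (Measurable.comap_le (by fun_prop))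

/-- For an event that is decided by the first `n` inputs, the joint probability with a given word
of bits is the weight of the word times a factor that does not depend on the parameter: the
probability of the corresponding section under the law of the randomizing variables. -/
lemma exists_real_inter_bits_eq {n : ℕ} {E : Set (ℕ → Bool × ℝ)} (hE : MeasurableSet[past n] E) :
    ∃ a : (Fin n → Bool) → ℝ, (∀ x, 0 ≤ a x) ∧ ∀ p ∈ Ioo (0 : ℝ) 1, ∀ x : Fin n → Bool,
      (inputLaw p).real (E ∩ {ω | (fun i : Fin n => (ω i).1) = x}) =
        (∏ i, bitWeight p (x i)) * a x := by
  obtain ⟨A, hA, rfl⟩ := hE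
  refine ⟨fun x => (Measure.pi fun _ : Fin n => (volume : Measure ℝ).restrict (Ioo 0 1)).real
    {u | (fun i => (x i, u i)) ∈ A}, fun x => measureReal_nonneg, fun p hp x => ?_⟩
  let β := bernoulliMeasure true false (projIcc (0 : ℝ) 1 zero_le_one p)
  let ν := (volume : Measure ℝ).restrict (Ioo 0 1)
  have hmp := measurePreserving_arrowProdEquivProdArrow Bool ℝ (Fin n) (fun _ => β) (fun _ => ν)
  have hU : MeasurableSet {u : Fin n → ℝ | (fun i => (x i, u i)) ∈ A} :=
    hA.preimage (by fun_prop)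
  have hset : firstInputs n ⁻¹' A ∩ {ω | (fun i : Fin n => (ω i).1) = x} =
      firstInputs n ⁻¹' (MeasurableEquiv.arrowProdEquivProdArrow Bool ℝ (Fin n) ⁻¹'
        ({x} ×ˢ {u : Fin n → ℝ | (fun i => (x i, u i)) ∈ A})) := by
    ext ω
    simp only [mem_inter_iff, mem_preimage, mem_ofPred_eq, mem_prod, mem_singleton_iff]
    constructor
    · rintro ⟨h, rfl⟩
      exact ⟨rfl, h⟩
    · rintro ⟨rfl, h⟩
      exact ⟨h, rfl⟩
  have hB : MeasurableSet ({x} ×ˢ {u : Fin n → ℝ | (fun i => (x i, u i)) ∈ A}) :=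
    (measurableSet_singleton x).prod hU
  rw [hset, ← map_measureReal_apply (measurable_firstInputs n) (hmp.measurable hB),
    map_firstInputs]
  change (Measure.pi fun _ : Fin n => β.prod ν).real _ = _
  rw [hmp.measureReal_preimage hB.nullMeasurableSet, measureReal_prod_prod]
  congr 1
  rw [measureReal_def, Measure.pi_singleton, ENNReal.toReal_prod]
  exact Finset.prod_congr rfl fun i _ => bernoulliMeasure_real_singleton hp (x i)

lemma measurable_bits (n : ℕ) :
    Measurable fun (ω : ℕ → Bool × ℝ) (i : Fin n) => (ω i).1 := by
  fun_prop

lemma setIntegral_comp_bits (p : ℝ) {n : ℕ} (E : Set (ℕ → Bool × ℝ))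
    (F : (Fin n → Bool) → ℝ) :
    ∫ ω in E, F (fun i : Fin n => (ω i).1) ∂inputLaw p =
      ∑ x, (inputLaw p).real (E ∩ {ω | (fun i : Fin n => (ω i).1) = x}) * F x := by
  have hm := measurable_bits n
  have hF : AEStronglyMeasurable F
      (((inputLaw p).restrict E).map fun ω (i : Fin n) => (ω i).1) :=
    (measurable_of_countable F).aestronglyMeasurable
  rw [← integral_map hm.aemeasurable hF, integral_fintype .of_finite]
  refine Finset.sum_congr rfl fun x _ => ?_
  rw [smul_eq_mul, map_measureReal_apply hm (measurableSet_singleton x),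
    measureReal_restrict_apply (hm (measurableSet_singleton x)), inter_comm]
  rfl

lemma real_eq_sum_bits (p : ℝ) (E : Set (ℕ → Bool × ℝ)) (n : ℕ) :
    (inputLaw p).real E =
      ∑ x, (inputLaw p).real (E ∩ {ω | (fun i : Fin n => (ω i).1) = x}) := by
  simpa using setIntegral_comp_bits p (n := n) E fun _ => 1

/-- The probability of an event decided by the first `n` inputs is a polynomial in the parameter,
and its derivative is the integral of the total score over the event. -/
lemma hasDerivAt_inputLaw_real {n : ℕ} {E : Set (ℕ → Bool × ℝ)}
    (hE : MeasurableSet[past n] E) {p : ℝ} (hp : p ∈ Ioo (0 : ℝ) 1) :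
    HasDerivAt (fun q => (inputLaw q).real E)
      (∫ ω in E, ∑ i : Fin n, score p (ω i).1 ∂inputLaw p) p := by
  obtain ⟨a, -, ha⟩ := exists_real_inter_bits_eq hE
  have h : HasDerivAt (fun q => ∑ x : Fin n → Bool, (∏ i, bitWeight q (x i)) * a x)
      (∑ x : Fin n → Bool, ((∏ i, bitWeight p (x i)) * ∑ i, score p (x i)) * a x) p :=
    HasDerivAt.fun_sum fun x _ => (hasDerivAt_prod_bitWeight hp x).mul_const (a x)
  have heq : (fun q => (inputLaw q).real E) =ᶠ[nhds p]
      fun q => ∑ x : Fin n → Bool, (∏ i, bitWeight q (x i)) * a x := by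
    filter_upwards [isOpen_Ioo.mem_nhds hp] with q hq
    rw [real_eq_sum_bits q E n]
    exact Finset.sum_congr rfl fun x _ => ha q hq x
  refine (h.congr_of_eventuallyEq heq).congr_deriv ?_
  rw [setIntegral_comp_bits p E fun x => ∑ i, score p (x i)]
  refine Finset.sum_congr rfl fun x _ => ?_
  rw [ha p hp x]
  ring

/-- A change of parameter multiplies the probability of an event decided by the first `n` inputs
by at most the `n`-th power of the largest ratio of the weights of a bit. -/
lemma inputLaw_real_le_pow_mul {n : ℕ} {E : Set (ℕ → Bool × ℝ)}
    (hE : MeasurableSet[past n] E) {p t r : ℝ} (hp : p ∈ Ioo (0 : ℝ) 1)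
    (ht : t ∈ Ioo (0 : ℝ) 1) (hr : ∀ b, bitWeight t b ≤ r * bitWeight p b) :
    (inputLaw t).real E ≤ r ^ n * (inputLaw p).real E := by
  obtain ⟨a, ha0, ha⟩ := exists_real_inter_bits_eq hE
  rw [real_eq_sum_bits t E n, real_eq_sum_bits p E n, Finset.mul_sum]
  refine Finset.sum_le_sum fun x _ => ?_
  rw [ha t ht, ha p hp, ← mul_assoc]
  refine mul_le_mul_of_nonneg_right ?_ (ha0 x)
  calc ∏ i, bitWeight t (x i) ≤ ∏ i, r * bitWeight p (x i) :=
        Finset.prod_le_prod (fun i _ => (bitWeight_pos ht _).le) fun i _ => hr _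
    _ = r ^ n * ∏ i, bitWeight p (x i) := by
        rw [Finset.prod_mul_distrib, Finset.prod_const, Finset.card_univ, Fintype.card_fin]

/-! ### Scores against the past -/

lemma indepFun_firstInputs_bit (p : ℝ) (n : ℕ) :
    IndepFun (firstInputs n) (fun ω => (ω n).1) (inputLaw p) := by
  have h : iIndepFun (fun (i : ℕ) (ω : ℕ → Bool × ℝ) => ω i) (inputLaw p) :=
    iIndepFun_infinitePi (P := fun _ => stepLaw p) (X := fun _ y => y) fun _ => measurable_id
  have h2 := h.indepFun_finset (Finset.range n) {n} (by simp) fun i => measurable_pi_apply i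
  exact h2.comp
    (φ := fun y (i : Fin n) => y ⟨i, Finset.mem_range.2 i.2⟩)
    (ψ := fun y => (y ⟨n, Finset.mem_singleton_self n⟩).1) (by fun_prop) (by fun_prop)

lemma integral_comp_bit {p : ℝ} (hp : p ∈ Ioo (0 : ℝ) 1) (n : ℕ) (F : Bool → ℝ) :
    ∫ ω, F (ω n).1 ∂inputLaw p = p * F true + (1 - p) * F false := by
  have h1 : (inputLaw p).map (fun ω => ω n) = stepLaw p :=
    Measure.infinitePi_map_eval (fun _ : ℕ => stepLaw p) n
  have hF : Measurable F := measurable_of_countable F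
  have h2 := integral_map (μ := inputLaw p) (φ := fun ω => ω n) (f := fun y => F y.1)
    (measurable_pi_apply n).aemeasurable (by fun_prop)
  rw [← h2, h1, stepLaw, integral_fun_fst, integral_bernoulliMeasure,
    projIcc_of_mem zero_le_one (Ioo_subset_Icc_self hp)]
  simp

lemma integral_mul_comp_bit (p : ℝ) {n : ℕ} {G : (ℕ → Bool × ℝ) → ℝ}
    (hG : Measurable[past n] G) (F : Bool → ℝ) :
    ∫ ω, G ω * F (ω n).1 ∂inputLaw p =
      (∫ ω, G ω ∂inputLaw p) * ∫ ω, F (ω n).1 ∂inputLaw p := by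
  have hF : Measurable F := measurable_of_countable F
  have hind : IndepFun G (fun ω => F (ω n).1) (inputLaw p) := by
    rw [IndepFun_iff_Indep]
    have h := (IndepFun_iff_Indep _ _ _).1 (indepFun_firstInputs_bit p n)
    refine indep_of_indep_of_le_right (indep_of_indep_of_le_left h hG.comap_le) ?_
    rintro _ ⟨s, hs, rfl⟩
    exact ⟨F ⁻¹' s, hF hs, rfl⟩
  exact hind.integral_fun_mul_eq_mul_integral
    (hG.mono (past_le n) le_rfl).aestronglyMeasurable
    (by fun_prop : Measurable fun ω : ℕ → Bool × ℝ => F (ω n).1).aestronglyMeasurable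

lemma integral_mul_score {p : ℝ} (hp : p ∈ Ioo (0 : ℝ) 1) {n : ℕ}
    {G : (ℕ → Bool × ℝ) → ℝ} (hG : Measurable[past n] G) :
    ∫ ω, G ω * score p (ω n).1 ∂inputLaw p = 0 := by
  have h1 : p ≠ 0 := hp.1.ne'
  have h2 : 1 - p ≠ 0 := (sub_pos.2 hp.2).ne'
  rw [integral_mul_comp_bit p hG, integral_comp_bit hp]
  simp [score, h1, h2]

lemma integral_mul_score_sq {p : ℝ} (hp : p ∈ Ioo (0 : ℝ) 1) {n : ℕ}
    {G : (ℕ → Bool × ℝ) → ℝ} (hG : Measurable[past n] G) :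
    ∫ ω, G ω * score p (ω n).1 ^ 2 ∂inputLaw p =
      (∫ ω, G ω ∂inputLaw p) / (p * (1 - p)) := by
  have h1 : p ≠ 0 := hp.1.ne'
  have h2 : 1 - p ≠ 0 := (sub_pos.2 hp.2).ne'
  rw [integral_mul_comp_bit p hG fun b => score p b ^ 2,
    integral_comp_bit hp n fun b => score p b ^ 2]
  simp only [score, if_true, Bool.false_eq_true, if_false]
  field_simp
  ring

lemma measurable_score_bit (p : ℝ) (i : ℕ) :
    Measurable fun ω : ℕ → Bool × ℝ => score p (ω i).1 :=
  (measurable_of_countable (score p)).comp (measurable_fst.comp (measurable_pi_apply i))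

lemma measurable_past_score_bit (p : ℝ) {i n : ℕ} (hi : i < n) :
    Measurable[past n] fun ω : ℕ → Bool × ℝ => score p (ω i).1 := by
  have h : Measurable fun y : Fin n → Bool × ℝ => score p (y ⟨i, hi⟩).1 :=
    (measurable_of_countable (score p)).comp (measurable_fst.comp (measurable_pi_apply _))
  exact h.comp (comap_measurable (firstInputs n))

lemma abs_score_le (p : ℝ) (b : Bool) : |score p b| ≤ |p⁻¹| + |(1 - p)⁻¹| := by
  cases b
  · simp [score]
  · simp [score]

/-! ### Scores collected before a stopping time -/

/-- The total score of those among the first `n` inputs that are read, when input `i` is read on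
the event `T i`. -/
noncomputable def stoppedScore (T : ℕ → Set (ℕ → Bool × ℝ)) (p : ℝ) (n : ℕ) (ω : ℕ → Bool × ℝ) :
    ℝ :=
  ∑ i ∈ Finset.range n, (T i).indicator 1 ω * score p (ω i).1

lemma measurable_past_indicator {n : ℕ} {E : Set (ℕ → Bool × ℝ)} (hE : MeasurableSet[past n] E) :
    Measurable[past n] (E.indicator (1 : (ℕ → Bool × ℝ) → ℝ)) :=
  (measurable_const (a := (1 : ℝ))).indicator hE

lemma measurable_past_stoppedScore {T : ℕ → Set (ℕ → Bool × ℝ)}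
    (hT : ∀ i, MeasurableSet[past i] (T i)) (p : ℝ) (n : ℕ) :
    Measurable[past n] (stoppedScore T p n) := by
  unfold stoppedScore
  refine Finset.measurable_fun_sum _ fun i hi => ?_
  have hi' := Finset.mem_range.1 hi
  exact (measurable_past_indicator (past_mono hi'.le _ (hT i))).mul (measurable_past_score_bit p hi')

lemma abs_indicator_one_mul_le {α : Type*} (E : Set α) (x : α) (y : ℝ) :
    |E.indicator 1 x * y| ≤ |y| := by
  by_cases h : x ∈ E <;> simp [h]

lemma abs_stoppedScore_le (T : ℕ → Set (ℕ → Bool × ℝ)) (p : ℝ) (n : ℕ) (ω : ℕ → Bool × ℝ) :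
    |stoppedScore T p n ω| ≤ n * (|p⁻¹| + |(1 - p)⁻¹|) := by
  refine (Finset.abs_sum_le_sum_abs _ _).trans ?_
  refine (Finset.sum_le_card_nsmul _ _ (|p⁻¹| + |(1 - p)⁻¹|) fun i _ => ?_).trans ?_
  · exact (abs_indicator_one_mul_le _ _ _).trans (abs_score_le p _)
  · simp [mul_add]

lemma integrable_of_abs_le {p : ℝ} {G : (ℕ → Bool × ℝ) → ℝ} (hG : Measurable G) (C : ℝ)
    (hC : ∀ ω, |G ω| ≤ C) : Integrable G (inputLaw p) :=
  Integrable.of_bound hG.aestronglyMeasurable C (Filter.Eventually.of_forall hC)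

/-- Wald's second identity: the stopped score is a sum of martingale differences, so its second
moment is the expected number of inputs read times the Fisher information of one input. -/
lemma integral_stoppedScore_sq {T : ℕ → Set (ℕ → Bool × ℝ)}
    (hT : ∀ i, MeasurableSet[past i] (T i)) {p : ℝ} (hp : p ∈ Ioo (0 : ℝ) 1) (n : ℕ) :
    ∫ ω, stoppedScore T p n ω ^ 2 ∂inputLaw p =
      (∑ i ∈ Finset.range n, (inputLaw p).real (T i)) / (p * (1 - p)) := by
  induction n with
  | zero => simp [stoppedScore]
  | succ n ih =>
    have hM := measurable_past_stoppedScore hT p n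
    have hI : Measurable[past n] ((T n).indicator (1 : (ℕ → Bool × ℝ) → ℝ)) :=
      measurable_past_indicator (hT n)
    have hM' := hM.mono (past_le n) le_rfl
    have hI' := hI.mono (past_le n) le_rfl
    have hs := measurable_score_bit p n
    set K := |p⁻¹| + |(1 - p)⁻¹|
    have hMb := abs_stoppedScore_le T p n
    have hsb : ∀ ω : ℕ → Bool × ℝ, |score p (ω n).1| ≤ K := fun ω => abs_score_le p _
    have hexp : ∀ ω, stoppedScore T p (n + 1) ω ^ 2 = stoppedScore T p n ω ^ 2 +
        (2 * stoppedScore T p n ω * (T n).indicator 1 ω) * score p (ω n).1 +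
        (T n).indicator 1 ω * score p (ω n).1 ^ 2 := by
      intro ω
      have h1 : (T n).indicator (1 : (ℕ → Bool × ℝ) → ℝ) ω ^ 2 = (T n).indicator 1 ω := by
        by_cases h : ω ∈ T n <;> simp [h]
      have h2 : stoppedScore T p (n + 1) ω =
          stoppedScore T p n ω + (T n).indicator 1 ω * score p (ω n).1 :=
        Finset.sum_range_succ _ _
      rw [h2]
      linear_combination score p (ω n).1 ^ 2 * h1
    have i1 : Integrable (fun ω => stoppedScore T p n ω ^ 2) (inputLaw p) := by
      refine integrable_of_abs_le (by fun_prop) ((n * K) ^ 2) fun ω => ?_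
      rw [abs_pow]
      exact pow_le_pow_left₀ (abs_nonneg _) (hMb ω) 2
    have i2 : Integrable (fun ω => (2 * stoppedScore T p n ω * (T n).indicator 1 ω) *
        score p (ω n).1) (inputLaw p) := by
      refine integrable_of_abs_le (by fun_prop) (2 * (n * K) * K) fun ω => ?_
      rw [mul_right_comm, mul_comm]
      refine (abs_indicator_one_mul_le _ _ _).trans ?_
      rw [abs_mul, abs_mul, abs_two]
      have := hMb ω
      have := hsb ω
      gcongr
    have i3 : Integrable (fun ω => (T n).indicator 1 ω * score p (ω n).1 ^ 2) (inputLaw p) := by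
      refine integrable_of_abs_le (by fun_prop) (K ^ 2) fun ω => ?_
      refine (abs_indicator_one_mul_le _ _ _).trans ?_
      rw [abs_pow]
      exact pow_le_pow_left₀ (abs_nonneg _) (hsb ω) 2
    have hG : Measurable[past n] fun ω => 2 * stoppedScore T p n ω * (T n).indicator 1 ω :=
      (hM.const_mul 2).mul hI
    rw [integral_congr_ae (.of_forall hexp), integral_add (by exact i1.add i2) i3, integral_add i1 i2, ih, integral_mul_score hp hG,
      integral_mul_score_sq hp hI, integral_indicator_one (past_le n _ (hT n)),
      Finset.sum_range_succ, add_zero, add_div]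

namespace Procedure

/-! ### Events determined by a procedure -/

variable (B : Procedure)

lemma stoppingTime_le_iff (ω : ℕ → Bool × ℝ) (m : ℕ) :
    B.stoppingTime ω ≤ m ↔ ∃ k : ℕ, 1 ≤ k ∧ k ≤ m ∧ B.stopFun k (firstInputs k ω) = true := by
  constructor
  · intro h
    have hne : {m : ℕ∞ | ∃ n : ℕ, m = n ∧ 1 ≤ n ∧
        B.stopFun n (firstInputs n ω) = true}.Nonempty := by
      by_contra hemp
      rw [not_nonempty_iff_eq_empty] at hemp
      rw [stoppingTime, hemp, sInf_empty] at h
      exact ENat.natCast_ne_top m (top_le_iff.1 h)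
    obtain ⟨k, hk, hk1, hks⟩ := csInf_mem hne
    exact ⟨k, hk1, by rw [stoppingTime, hk] at h; exact_mod_cast h, hks⟩
  · rintro ⟨k, hk1, hkm, hks⟩
    have hle : B.stoppingTime ω ≤ k := sInf_le ⟨k, rfl, hk1, hks⟩
    exact hle.trans (by exact_mod_cast hkm)

lemma outputValue_eq {ω : ℕ → Bool × ℝ} {k : ℕ} (h : B.stoppingTime ω = k) :
    B.outputValue ω = B.outputFun k (firstInputs k ω) := by
  rw [outputValue, h, ENat.toNat_natCast]

/-- The event that input `n` (counted from `0`) is read, that is, `N > n`. -/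
def readEvent (n : ℕ) : Set (ℕ → Bool × ℝ) := {ω | (n : ℕ∞) < B.stoppingTime ω}

/-- The event that the procedure stops after at most `n` inputs with output `1`. -/
def acceptEvent (n : ℕ) : Set (ℕ → Bool × ℝ) :=
  {ω | B.stoppingTime ω ≤ n ∧ B.outputValue ω = true}

lemma measurableSet_past_readEvent (n : ℕ) : MeasurableSet[past n] (B.readEvent n) := by
  have h : B.readEvent n =
      (⋃ k ∈ Icc 1 n, {ω | B.stopFun k (firstInputs k ω) = true})ᶜ := by
    ext ω
    rw [readEvent, mem_ofPred_eq, ← not_le, stoppingTime_le_iff]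
    simp
  rw [h]
  refine (MeasurableSet.biUnion (to_countable _) fun k hk => ?_).compl
  exact past_mono hk.2 _
    ⟨B.stopFun k ⁻¹' {true}, B.measurable_stopFun k (measurableSet_singleton _), rfl⟩

lemma measurableSet_past_acceptEvent (n : ℕ) : MeasurableSet[past n] (B.acceptEvent n) := by
  -- The event `N = k` is the complement of `N > k` minus the complements of `N > j`, `j < k`.
  have h : B.acceptEvent n = ⋃ k ∈ Iic n, ((B.readEvent k)ᶜ \ ⋃ j ∈ Iio k, (B.readEvent j)ᶜ) ∩
      {ω | B.outputFun k (firstInputs k ω) = true} := by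
    ext ω
    simp only [acceptEvent, readEvent, mem_ofPred_eq, mem_iUnion, mem_inter_iff, mem_sdiff,
      mem_compl_iff, not_lt, mem_Iic, mem_Iio, exists_prop, not_exists, not_and, not_le]
    constructor
    · rintro ⟨h1, h2⟩
      obtain ⟨k, hk⟩ := ENat.ne_top_iff_exists.1 (ne_top_of_le_ne_top (ENat.natCast_ne_top n) h1)
      refine ⟨k, by rw [← hk] at h1; exact_mod_cast h1, ⟨hk.ge, fun j hj => ?_⟩, ?_⟩
      · rw [← hk]; exact_mod_cast hj
      · rwa [B.outputValue_eq hk.symm] at h2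
    · rintro ⟨k, hkn, ⟨hk1, hk2⟩, hk3⟩
      have hk : B.stoppingTime ω = k := by
        refine le_antisymm hk1 ?_
        rcases Nat.eq_zero_or_pos k with rfl | hpos
        · simp
        · have := hk2 (k - 1) (by omega)
          have h2 := Order.add_one_le_of_lt this
          have h3 : k - 1 + 1 = k := by omega
          rw [← h3]; exact_mod_cast h2
      exact ⟨hk1.trans (by exact_mod_cast hkn), by rwa [B.outputValue_eq hk]⟩
  rw [h]
  refine MeasurableSet.biUnion (to_countable _) fun k hk => past_mono hk _ ?_
  refine ((B.measurableSet_past_readEvent k).compl.diff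
    (MeasurableSet.biUnion (to_countable _) fun j hj => past_mono (le_of_lt hj) _
      (B.measurableSet_past_readEvent j).compl)).inter ?_
  exact ⟨B.outputFun k ⁻¹' {true}, B.measurable_outputFun k (measurableSet_singleton _), rfl⟩

lemma acceptEvent_diff_readEvent {i n : ℕ} (hi : i ≤ n) :
    B.acceptEvent n \ B.readEvent i = B.acceptEvent i := by
  ext ω
  simp only [acceptEvent, readEvent, mem_sdiff, mem_ofPred_eq, not_lt]
  have : (i : ℕ∞) ≤ n := by exact_mod_cast hi
  exact ⟨fun h => ⟨h.2, h.1.2⟩, fun h => ⟨⟨h.1.trans this, h.2⟩, h.1⟩⟩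

/-- The tail-sum formula for the expected number of inputs. -/
lemma toReal_expectedInputs (p : ℝ) :
    (B.expectedInputs p).toReal = ∑' n, (inputLaw p).real (B.readEvent n) := by
  have hpt : ∀ ω, (B.stoppingTime ω : ENNReal) =
      ∑' n, (B.readEvent n).indicator (1 : (ℕ → Bool × ℝ) → ENNReal) ω := by
    intro ω
    have h1 : ∀ n, (B.readEvent n).indicator (1 : (ℕ → Bool × ℝ) → ENNReal) ω =
        {k : ℕ | (k : ℕ∞) < B.stoppingTime ω}.indicator (fun _ => 1) n := fun n => rfl
    simp_rw [h1]
    rw [← tsum_subtype, ENNReal.tsum_set_one]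
    congr 1
    induction B.stoppingTime ω with
    | top => simp
    | coe m =>
      have : {k : ℕ | (k : ℕ∞) < m} = ((Finset.range m : Finset ℕ) : Set ℕ) := by
        ext k; simp
      rw [this, encard_coe_eq_coe_finsetCard, Finset.card_range]
  have hm : ∀ n, MeasurableSet (B.readEvent n) := fun n =>
    past_le n _ (B.measurableSet_past_readEvent n)
  rw [expectedInputs, lintegral_congr hpt,
    lintegral_tsum fun n => (measurable_one.indicator (hm n)).aemeasurable]
  simp_rw [lintegral_indicator_one (hm _)]
  exact ENNReal.tsum_toReal_eq fun n => measure_ne_top _ _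

/-! ### The information inequality -/

/-- Scores of inputs that are not read do not contribute to the derivative of the acceptance
probability, because they are centred given the past. -/
lemma setIntegral_score_eq_stoppedScore {p : ℝ} (hp : p ∈ Ioo (0 : ℝ) 1) (n : ℕ) :
    ∫ ω in B.acceptEvent n, ∑ i : Fin n, score p (ω i).1 ∂inputLaw p =
      ∫ ω in B.acceptEvent n, stoppedScore B.readEvent p n ω ∂inputLaw p := by
  have hint : ∀ i, Integrable (fun ω : ℕ → Bool × ℝ => score p (ω i).1) (inputLaw p) := fun i =>
    integrable_of_abs_le (measurable_score_bit p i) _ fun ω => abs_score_le p _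
  have hR : ∀ i, MeasurableSet (B.readEvent i) := fun i =>
    past_le i _ (B.measurableSet_past_readEvent i)
  have hterm : ∀ i (ω : ℕ → Bool × ℝ), (B.readEvent i).indicator 1 ω * score p (ω i).1 =
      (B.readEvent i).indicator (fun ω => score p (ω i).1) ω := by
    intro i ω
    by_cases h : ω ∈ B.readEvent i <;> simp [h]
  unfold stoppedScore
  simp_rw [fun ω : ℕ → Bool × ℝ => Fin.sum_univ_eq_sum_range (fun i => score p (ω i).1) n, hterm]
  rw [integral_finsetSum _ fun i _ => (hint i).integrableOn,
    integral_finsetSum _ fun i _ => ((hint i).indicator (hR i)).integrableOn]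
  refine Finset.sum_congr rfl fun i hi => ?_
  rw [setIntegral_indicator (hR i),
    ← integral_inter_add_sdiff (hR i) (hint i).integrableOn,
    B.acceptEvent_diff_readEvent (Finset.mem_range.1 hi).le]
  have h0 := integral_mul_score hp
    (measurable_past_indicator (B.measurableSet_past_acceptEvent i))
  have h1 : ∀ ω : ℕ → Bool × ℝ, (B.acceptEvent i).indicator 1 ω * score p (ω i).1 =
      (B.acceptEvent i).indicator (fun ω => score p (ω i).1) ω := by
    intro ω
    by_cases h : ω ∈ B.acceptEvent i <;> simp [h]
  simp_rw [h1] at h0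
  rw [integral_indicator (past_le i _ (B.measurableSet_past_acceptEvent i))] at h0
  rw [h0, add_zero]

/-- The sequential Cramér–Rao inequality for the procedure truncated after `n` inputs, with the
product of the two second moments replaced by a weighted sum. -/
lemma deriv_acceptEvent_le {p : ℝ} (hp : p ∈ Ioo (0 : ℝ) 1) (n : ℕ) {c : ℝ} (hc : 0 < c) :
    deriv (fun q => (inputLaw q).real (B.acceptEvent n)) p ≤
      (c * (inputLaw p).real (B.acceptEvent n) +
        (∑ i ∈ Finset.range n, (inputLaw p).real (B.readEvent i)) / (p * (1 - p)) / c) / 2 := by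
  have hA := past_le n _ (B.measurableSet_past_acceptEvent n)
  have hM := (measurable_past_stoppedScore B.measurableSet_past_readEvent p n).mono
    (past_le n) le_rfl
  have hMb := abs_stoppedScore_le B.readEvent p n
  rw [(hasDerivAt_inputLaw_real (B.measurableSet_past_acceptEvent n) hp).deriv,
    B.setIntegral_score_eq_stoppedScore hp, ← integral_stoppedScore_sq
      B.measurableSet_past_readEvent hp, ← integral_indicator_one hA, ← integral_indicator hA,
    ← integral_const_mul, ← integral_div]
  have i0 : Integrable (fun ω => c * (B.acceptEvent n).indicator (1 : (ℕ → Bool × ℝ) → ℝ) ω) (inputLaw p) :=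
    ((integrable_const 1).indicator hA).const_mul c
  have i1 : Integrable (fun ω => stoppedScore B.readEvent p n ω ^ 2 / c) (inputLaw p) := by
    refine (integrable_of_abs_le (hM.pow_const 2) ((n * (|p⁻¹| + |(1 - p)⁻¹|)) ^ 2)
      fun ω => ?_).div_const c
    rw [abs_pow]
    exact pow_le_pow_left₀ (abs_nonneg _) (hMb ω) 2
  rw [← integral_add i0 i1, ← integral_div]
  refine integral_mono ((integrable_of_abs_le hM _ hMb).indicator hA) ((i0.add i1).div_const 2)
    fun ω => ?_
  by_cases h : ω ∈ B.acceptEvent n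
  · simp only [indicator_of_mem h, Pi.one_apply, mul_one]
    have h2 : 0 ≤ (c - stoppedScore B.readEvent p n ω) ^ 2 / c := by positivity
    have h3 : (c - stoppedScore B.readEvent p n ω) ^ 2 / c =
        c - 2 * stoppedScore B.readEvent p n ω + stoppedScore B.readEvent p n ω ^ 2 / c := by
      field_simp
      ring
    linarith
  · simp only [indicator_of_notMem h, mul_zero, zero_add]
    positivity

end Procedure

/-! ### Comparison of nearby parameters -/

/-- The largest ratio of the weights of a bit under the parameters `t` and `p`. -/
noncomputable def weightRatio (p t : ℝ) : ℝ := max (t / p) ((1 - t) / (1 - p))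

lemma weightRatio_self {p : ℝ} (hp : p ∈ Ioo (0 : ℝ) 1) : weightRatio p p = 1 := by
  rw [weightRatio, div_self hp.1.ne', div_self (sub_pos.2 hp.2).ne', max_self]

lemma continuous_weightRatio (p : ℝ) : Continuous (weightRatio p) := by
  unfold weightRatio; fun_prop

lemma bitWeight_le_weightRatio_mul {p : ℝ} (hp : p ∈ Ioo (0 : ℝ) 1) (t : ℝ) (b : Bool) :
    bitWeight t b ≤ weightRatio p t * bitWeight p b := by
  rw [← div_le_iff₀ (bitWeight_pos hp b)]
  cases b
  · exact le_max_right _ _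
  · exact le_max_left _ _

/-- A power series whose coefficients decay geometrically with ratio `β < 1` converges on a disc
of radius greater than `1` and is continuous there. -/
lemma exists_continuousOn_tsum_mul_pow {a : ℕ → ℝ} {A β : ℝ} (hβ0 : 0 ≤ β) (hβ1 : β < 1)
    (ha0 : ∀ n, 0 ≤ a n) (ha : ∀ n, a n ≤ A * β ^ n) :
    ∃ R > (1 : ℝ), (∀ r ∈ Icc 0 R, Summable fun n => r ^ n * a n) ∧
      ContinuousOn (fun r => ∑' n, r ^ n * a n) (Icc 0 R) := by
  have hR : 1 < 2 / (1 + β) := by rw [lt_div_iff₀ (by linarith)]; linarith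
  have hRβ : 2 / (1 + β) * β < 1 := by
    rw [div_mul_eq_mul_div, div_lt_one (by linarith)]; linarith
  have hsum : Summable fun n : ℕ => A * (2 / (1 + β) * β) ^ n :=
    (summable_geometric_of_lt_one (by positivity) hRβ).mul_left A
  have hbound : ∀ n : ℕ, ∀ r ∈ Icc 0 (2 / (1 + β)),
      ‖r ^ n * a n‖ ≤ A * (2 / (1 + β) * β) ^ n := by
    intro n r hr
    rw [Real.norm_of_nonneg (mul_nonneg (pow_nonneg hr.1 n) (ha0 n))]
    calc r ^ n * a n ≤ (2 / (1 + β)) ^ n * (A * β ^ n) :=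
          mul_le_mul (pow_le_pow_left₀ hr.1 hr.2 n) (ha n) (ha0 n) (by positivity)
      _ = A * (2 / (1 + β) * β) ^ n := by rw [mul_pow]; ring
  refine ⟨2 / (1 + β), hR, fun r hr => Summable.of_norm_bounded hsum fun n => hbound n r hr, ?_⟩
  exact continuousOn_tsum (fun n => by fun_prop) hsum hbound

namespace Procedure

/-! ### Passage to the limit -/

variable {B : Procedure} {S : Set ℝ} {f : ℝ → ℝ}

lemma IsFast.exists_geometric_bound (hfast : B.IsFast S) {p : ℝ} (hp : p ∈ S) :
    ∃ A > (0 : ℝ), ∃ β : ℝ, 0 ≤ β ∧ β < 1 ∧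
      ∀ n : ℕ, (inputLaw p).real (B.readEvent n) ≤ A * β ^ n := by
  obtain ⟨A, hA, β, hβ, h⟩ := hfast p hp
  refine ⟨A, hA, β, ?_, hβ, h⟩
  have h1 : 0 ≤ A * β ^ 1 := measureReal_nonneg.trans (h 1)
  rw [pow_one] at h1
  exact nonneg_of_mul_nonneg_right h1 hA

lemma IsFactoryFor.acceptEvent_le (hB : B.IsFactoryFor S f) {p : ℝ} (hp : p ∈ S) (n : ℕ) :
    (inputLaw p).real (B.acceptEvent n) ≤ f p := by
  rw [← (hB p hp).2]
  exact measureReal_mono fun ω hω => hω.2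

lemma IsFactoryFor.tendsto_acceptEvent (hB : B.IsFactoryFor S f) (hfast : B.IsFast S)
    {p : ℝ} (hp : p ∈ S) :
    Filter.Tendsto (fun n => (inputLaw p).real (B.acceptEvent n)) Filter.atTop (nhds (f p)) := by
  obtain ⟨A, hA, β, hβ0, hβ1, hβ⟩ := hfast.exists_geometric_bound hp
  have hlim : Filter.Tendsto (fun n : ℕ => f p - A * β ^ n) Filter.atTop (nhds (f p)) := by
    simpa using ((tendsto_pow_atTop_nhds_zero_of_lt_one hβ0 hβ1).const_mul A).const_sub (f p)
  refine tendsto_of_tendsto_of_tendsto_of_le_of_le hlim tendsto_const_nhds (fun n => ?_)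
    fun n => hB.acceptEvent_le hp n
  have hsub : {ω | B.outputValue ω = true} ⊆ B.acceptEvent n ∪ B.readEvent n := fun ω hω =>
    (le_or_gt (B.stoppingTime ω) n).imp (fun h => ⟨h, hω⟩) id
  have h1 := (measureReal_mono (μ := inputLaw p) hsub).trans (measureReal_union_le _ _)
  rw [(hB p hp).2] at h1
  have h2 := hβ n
  simp only
  linarith

/-- The sequential Cramér–Rao inequality for a fast factory. Speed enters twice: it lets the
truncated acceptance probabilities converge to `f`, and it makes the expected number of inputs
near `p` bounded by a function of the parameter that is continuous at `p`. -/
theorem IsFactoryFor.deriv_le (hS : IsOpen S) (hS01 : S ⊆ Ioo 0 1)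
    (hf : DifferentiableOn ℝ f S) (hB : B.IsFactoryFor S f) (hfast : B.IsFast S)
    {p : ℝ} (hp : p ∈ S) {c : ℝ} (hc : 0 < c) :
    deriv f p ≤ (c * f p + (B.expectedInputs p).toReal / (p * (1 - p)) / c) / 2 := by
  have hp01 := hS01 hp
  have hp0 : p * (1 - p) ≠ 0 := (mul_pos hp01.1 (sub_pos.2 hp01.2)).ne'
  have hfp : DifferentiableAt ℝ f p := hf.differentiableAt (hS.mem_nhds hp)
  obtain ⟨A, hA, β, hβ0, hβ1, hβ⟩ := hfast.exists_geometric_bound hp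
  obtain ⟨R, hR1, hsum, hcont⟩ := exists_continuousOn_tsum_mul_pow hβ0 hβ1
    (fun n => measureReal_nonneg) hβ
  set φ : ℝ → ℝ := fun r => ∑' n, r ^ n * (inputLaw p).real (B.readEvent n)
  -- `H t` bounds the derivative at `t` of every truncated acceptance probability.
  let H : ℝ → ℝ := fun t => (c * f t + φ (weightRatio p t) / (t * (1 - t)) / c) / 2
  have hHp : H p = (c * f p + (B.expectedInputs p).toReal / (p * (1 - p)) / c) / 2 := by
    simp [H, φ, weightRatio_self hp01, toReal_expectedInputs]
  have hφ : ContinuousAt (fun t => φ (weightRatio p t)) p := by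
    have h1 : ContinuousAt φ (weightRatio p p) := by
      rw [weightRatio_self hp01]
      exact hcont.continuousAt (Icc_mem_nhds zero_lt_one hR1)
    exact ContinuousAt.comp (f := weightRatio p) h1 (continuous_weightRatio p).continuousAt
  have hH : ContinuousAt H p := by
    have h1 : ContinuousAt (fun t : ℝ => t * (1 - t)) p := by fun_prop
    exact (((hfp.continuousAt.const_mul c).add ((hφ.div h1 hp0).div_const c)).div_const 2)
  rw [← hHp]
  refine le_of_forall_gt_imp_ge_of_dense fun K hK => ?_
  have hnhds : ∀ᶠ t in nhds p, t ∈ S ∧ weightRatio p t < R ∧ H t < K :=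
    (hS.eventually_mem hp).and (((continuous_weightRatio p).continuousAt.eventually_lt_const
      (by rwa [weightRatio_self hp01])).and (hH.eventually_lt_const hK))
  obtain ⟨ε, hε, hball⟩ := Metric.eventually_nhds_iff_ball.1 hnhds
  have hder : ∀ n : ℕ, ∀ t ∈ Metric.ball p ε,
      deriv (fun q => (inputLaw q).real (B.acceptEvent n)) t ≤ K := by
    intro n t ht
    obtain ⟨htS, htR, htH⟩ := hball t ht
    have ht01 := hS01 htS
    have hr0 : 0 ≤ weightRatio p t :=
      (div_nonneg ht01.1.le hp01.1.le).trans (le_max_left _ _)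
    refine (B.deriv_acceptEvent_le ht01 n hc).trans (le_trans ?_ htH.le)
    have h1 := hB.acceptEvent_le htS n
    have h2 : ∑ i ∈ Finset.range n, (inputLaw t).real (B.readEvent i) ≤ φ (weightRatio p t) :=
      (Finset.sum_le_sum fun i _ => inputLaw_real_le_pow_mul (B.measurableSet_past_readEvent i)
        hp01 ht01 (bitWeight_le_weightRatio_mul hp01 t)).trans
        ((hsum _ ⟨hr0, htR.le⟩).sum_le_tsum _ fun i _ =>
          mul_nonneg (pow_nonneg hr0 i) measureReal_nonneg)
    have h3 : 0 ≤ t * (1 - t) := mul_nonneg ht01.1.le (sub_nonneg.2 ht01.2.le)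
    simp only [H]
    gcongr
  have hincr : ∀ q ∈ Metric.ball p ε, p < q → f q - f p ≤ K * (q - p) := by
    intro q hq hpq
    have hdiff : ∀ n : ℕ, DifferentiableOn ℝ (fun q => (inputLaw q).real (B.acceptEvent n))
        (Metric.ball p ε) := fun n t ht =>
      (hasDerivAt_inputLaw_real (B.measurableSet_past_acceptEvent n)
        (hS01 (hball t ht).1)).differentiableAt.differentiableWithinAt
    refine le_of_tendsto ((hB.tendsto_acceptEvent hfast (hball q hq).1).sub
      (hB.tendsto_acceptEvent hfast hp)) (Filter.Eventually.of_forall fun n => ?_)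
    refine (convex_ball p ε).image_sub_le_mul_sub_of_deriv_le (hdiff n).continuousOn
      ((hdiff n).mono interior_subset) (fun t ht => hder n t (interior_subset ht)) p
      (Metric.mem_ball_self hε) q hq hpq.le
  have hslope : Filter.Tendsto (slope f p) (nhdsWithin p (Ioi p)) (nhds (deriv f p)) :=
    (hasDerivAt_iff_tendsto_slope.1 hfp.hasDerivAt).mono_left
      (nhdsWithin_mono p fun x hx => (ne_of_gt hx))
  refine le_of_tendsto hslope ?_
  filter_upwards [self_mem_nhdsWithin, nhdsWithin_le_nhds (Metric.ball_mem_nhds p hε)]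
    with q hpq hq
  rw [slope_def_field, div_le_iff₀ (sub_pos.2 hpq)]
  exact hincr q hq hpq

end Procedure

end BernoulliFactory

open BernoulliFactory in
/-- `f` is used on `S` only; `deriv f` is its derivative there because `S` is open. As `f p / p > 0`
on `S`, the conclusion also says that `E[N]` is finite at the points where the bound is asserted. -/
theorem mainTheorem2 (S : Set ℝ) (hS : IsOpen S) (hS01 : S ⊆ Set.Ioo 0 1)
    (hS0 : AccPt (0 : ℝ) (Filter.principal S))
    (f : ℝ → ℝ) (hf01 : ∀ p ∈ S, f p ∈ Set.Ioo (0 : ℝ) 1) (hf : DifferentiableOn ℝ f S)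
    (hf' : IsOmega S 0 (deriv f) (fun p => f p / p))
    (B : Procedure) (hB : B.IsFactoryFor S f) (hfast : B.IsFast S) :
    IsOmega S 0 (fun p => (B.expectedInputs p).toReal) (fun p => f p / p) := by
  obtain ⟨C, hC, δ, hδ, h⟩ := hf'
  refine ⟨C ^ 2 / 2, by positivity, min δ (1 / 2), by positivity, fun p hp hpδ => ?_⟩
  have hp0 : 0 < p := (hS01 hp).1
  have hp1 : 0 < 1 - p := sub_pos.2 (hS01 hp).2
  have hp2 : p < 1 / 2 := by
    have := hpδ.trans_le (min_le_right _ _)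
    rwa [sub_zero, abs_of_pos hp0] at this
  have hfp := (hf01 p hp).1
  have h1 : C * (f p / p) ≤ deriv f p := h p hp (hpδ.trans_le (min_le_left _ _))
  -- The weight `C / p` makes the first term of the bound half of the lower bound for `f' p`.
  have h2 := hB.deriv_le hS hS01 hf hfast hp (c := C / p) (by positivity)
  have h3 : (B.expectedInputs p).toReal / (p * (1 - p)) / (C / p) =
      (B.expectedInputs p).toReal / ((1 - p) * C) := by
    field_simp
  have h4 : C * (f p / p) ≤ (B.expectedInputs p).toReal / ((1 - p) * C) := by
    have h5 : C / p * f p = C * (f p / p) := by ring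
    rw [h3, h5] at h2
    linarith
  rw [le_div_iff₀ (by positivity)] at h4
  refine le_trans ?_ h4
  have h6 : 0 ≤ C ^ 2 * (f p / p) := by positivity
  nlinarith
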